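/- All graphs are finite and simple. A vertex cover of a graph $G$ with vertex set $X$ is a set $W\subseteq X$ meeting every edge of $G$; it is minimal if no proper subset of $W$ is a vertex cover. A graph $G$ with vertex set $X$ is very well-covered if it has no isolated vertices and all its minimal vertex covers have cardinality $\tfrac12|X|$. Let $\Bbbk$ be a field and let $I(G)\subseteq\Bbbk[X]$ be the edge ideal of $G$, generated by the monomials $xy$ with $\{x,y\}$ an edge of $G$. For $s\in\mathbb N=\{0,1,2,\dots\}$ let $\mathcal J_s(X)=\{x_j : x\in X,\ 0\le j\le s\}$, and let $\phi_s\colon \Bbbk[X]\to\Bbbk[\mathcal J_s(X)][t]/\langle t^{s+1}\rangle$ be the homomorphism of $\Bbbk$-algebras with $\phi_s(x)=\sum_{j=0}^s x_jt^j$. The ideal of $s$-jets $\mathcal J_s(I)$ of an ideal $I$ of $\Bbbk[X]$ is the ideal of $\Bbbk[\mathcal J_s(X)]$ generated by the coefficients of $t^0,\dots,t^s$ in $\phi_s(f)$ for $f\in I$ (equivalently, for $f$ in a generating set of $I$). The graph of $s$-jets $\mathcal J_s(G)$ is the graph with vertex set $\mathcal J_s(X)$ whose edge ideal is $\sqrt{\mathcal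 J_s(I(G))}$. **Theorem.** Let $G$ be a very well-covered graph. Then, for every field $\Bbbk$ and every $s\in\mathbb N$, the graph of $s$-jets $\mathcal J_s(G)$ is well defined (that is, $\sqrt{\mathcal J_s(I(G))}$ is the edge ideal of a unique graph on $\mathcal J_s(X)$), and $\mathcal J_s(G)$ is also very well-covered. -/

import Mathlib

noncomputable section

namespace JetGraph

/-- The vertex set of `s`-jets of `V`: the pair `(x, j)` stands for `x_j`, where `0 ≤ j ≤ s`. -/
abbrev JetVertex (V : Type*) (s : ℕ) : Type _ := V × Fin (s + 1)

/-- The edge ideal of a graph `G` in the polynomial ring `k[V]`: the ideal generated by the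
monomials `x y` with `{x, y}` an edge of `G`. -/
def edgeIdeal (k : Type*) [Field k] {V : Type*} (G : SimpleGraph V) :
    Ideal (MvPolynomial V k) :=
  Ideal.span {f | ∃ x y : V, G.Adj x y ∧ f = MvPolynomial.X x * MvPolynomial.X y}

/-- The substitution `x ↦ x_0 + x_1 t + ⋯ + x_s t ^ s`. It takes values in
`k[x_j : x ∈ V, 0 ≤ j ≤ s][t]`; working modulo `t ^ (s + 1)` amounts to looking only at the
coefficients of `t ^ j` for `j ≤ s`, and this is the only way in which it is used below. -/
def jetHom (k : Type*) [Field k] (V : Type*) (s : ℕ) :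
    MvPolynomial V k →ₐ[k] Polynomial (MvPolynomial (JetVertex V s) k) :=
  MvPolynomial.aeval fun x =>
    ∑ j : Fin (s + 1), Polynomial.C (MvPolynomial.X (x, j)) * Polynomial.X ^ (j : ℕ)

/-- The ideal of `s`-jets of an ideal `I`: it is generated by the coefficients of `t ^ j`, `j ≤ s`,
of the images of the elements of `I` under `jetHom`. Generators of `I` suffice,
see `jetIdeal_span`. -/
def jetIdeal {k : Type*} [Field k] {V : Type*} (s : ℕ) (I : Ideal (MvPolynomial V k)) :
    Ideal (MvPolynomial (JetVertex V s) k) :=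
  Ideal.span {g | ∃ f ∈ I, ∃ j : Fin (s + 1), g = (jetHom k V s f).coeff (j : ℕ)}

/-- The ideal of `s`-jets can be computed from any set of generators. -/
theorem jetIdeal_span {k : Type*} [Field k] {V : Type*} (s : ℕ) (S : Set (MvPolynomial V k)) :
    jetIdeal s (Ideal.span S) =
      Ideal.span {g | ∃ f ∈ S, ∃ j : Fin (s + 1), g = (jetHom k V s f).coeff (j : ℕ)} := by
  apply le_antisymm
  · refine Ideal.span_le.2 ?_
    rintro _ ⟨f, hf, j, rfl⟩
    have key : ∀ i : ℕ, i < s + 1 → (jetHom k V s f).coeff i ∈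
        Ideal.span {g | ∃ f ∈ S, ∃ j : Fin (s + 1), g = (jetHom k V s f).coeff (j : ℕ)} := by
      induction hf using Submodule.span_induction with
      | mem x hx => exact fun i hi => Ideal.subset_span ⟨x, hx, ⟨i, hi⟩, rfl⟩
      | zero => intro i _; simp
      | add x y _ _ hx hy =>
        intro i hi
        rw [map_add, Polynomial.coeff_add]
        exact Ideal.add_mem _ (hx i hi) (hy i hi)
      | smul a x _ hx =>
        intro i hi
        rw [smul_eq_mul, map_mul, Polynomial.coeff_mul]
        refine Ideal.sum_mem _ fun p hp => Ideal.mul_mem_left _ _ (hx p.2 ?_)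
        have := Finset.HasAntidiagonal.mem_antidiagonal.1 hp
        omega
    exact key j j.2
  · refine Ideal.span_mono ?_
    rintro _ ⟨f, hf, j, rfl⟩
    exact ⟨f, Ideal.subset_span hf, j, rfl⟩

/-- The graph of `s`-jets of `G`: the graph on the vertices `x_j` whose edge ideal is the radical
of the ideal of `s`-jets of the edge ideal of `G`. Its edges are read off from that radical;
see `eq_jetGraph_of_edgeIdeal_eq`. -/
def jetGraph (k : Type*) [Field k] {V : Type*} (s : ℕ) (G : SimpleGraph V) :
    SimpleGraph (JetVertex V s) where
  Adj a b := a ≠ b ∧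
    (MvPolynomial.X a * MvPolynomial.X b : MvPolynomial (JetVertex V s) k) ∈
      (jetIdeal s (edgeIdeal k G)).radical
  symm := ⟨fun _ _ h => ⟨h.1.symm, by rw [mul_comm]; exact h.2⟩⟩
  loopless := ⟨fun _ h => h.1 rfl⟩

/-- A graph can be recovered from its edge ideal. -/
theorem X_mul_X_mem_edgeIdeal_iff (k : Type*) [Field k] {V : Type*} (G : SimpleGraph V)
    {a b : V} (hab : a ≠ b) :
    (MvPolynomial.X a * MvPolynomial.X b : MvPolynomial V k) ∈ edgeIdeal k G ↔ G.Adj a b := by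
  refine ⟨fun h => ?_, fun h => Ideal.subset_span ⟨a, b, h, rfl⟩⟩
  have hzero : ¬ G.Adj a b → False := by
    intro hn
    -- evaluate at the point whose nonzero coordinates are exactly `a` and `b`
    classical
    let p : V → k := fun v => if v = a ∨ v = b then 1 else 0
    have hle : edgeIdeal k G ≤ RingHom.ker (MvPolynomial.eval p) := by
      refine Ideal.span_le.2 ?_
      rintro _ ⟨x, y, hxy, rfl⟩
      have hne := hxy.ne
      have hs := hxy.symm
      simp only [SetLike.mem_coe, RingHom.mem_ker, map_mul, MvPolynomial.eval_X, p]
      by_cases hx : x = a ∨ x = b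
      · by_cases hy : y = a ∨ y = b
        · exfalso
          rcases hx with rfl | rfl <;> rcases hy with rfl | rfl <;> simp_all
        · simp [hy]
      · simp [hx]
    have := hle h
    simp [RingHom.mem_ker, p] at this
  by_contra hn
  exact hzero hn

/-- A graph whose edge ideal is the radical of the ideal of `s`-jets of the edge ideal of `G` is
the graph of `s`-jets of `G`. -/
theorem eq_jetGraph_of_edgeIdeal_eq (k : Type*) [Field k] {V : Type*} (s : ℕ)
    (G : SimpleGraph V) (H : SimpleGraph (JetVertex V s))
    (hH : edgeIdeal k H = (jetIdeal s (edgeIdeal k G)).radical) : H = jetGraph k s G := by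
  ext a b
  constructor
  · intro h
    refine ⟨h.ne, ?_⟩
    rw [← hH]
    exact (X_mul_X_mem_edgeIdeal_iff k H h.ne).2 h
  · rintro ⟨hne, h⟩
    rw [← hH] at h
    exact (X_mul_X_mem_edgeIdeal_iff k H hne).1 h

/-- `W` is a minimal vertex cover of `G`. -/
def IsMinimalVertexCover {V : Type*} (G : SimpleGraph V) (W : Set V) : Prop :=
  Minimal G.IsVertexCover W

/-- A (finite) graph is very well-covered if it has no isolated vertex and all its minimal vertex
covers have cardinality equal to half the number of vertices. -/
def IsVeryWellCovered {V : Type*} (G : SimpleGraph V) : Prop :=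
  (∀ v, ¬ G.IsIsolated v) ∧
    ∀ W : Set V, IsMinimalVertexCover G W → 2 * W.ncard = Nat.card V

end JetGraph

end

/-! Modulo a prime containing the jet ideal, a Gauss-lemma argument kills each product `x_i y_j`
with `xy` an edge and `i + j ≤ s`. The radical is therefore the edge ideal of `truncatedProduct G
s`, whatever the field. A finite graph is very well-covered exactly when it has an `IsExchangePerm`.
This is Favaron's criterion with a permutation, not necessarily an involution, in place of a perfect
matching. Hall's theorem supplies the permutation `σ`, and `(x, i) ↦ (σ x, s - i)` is an exchange
permutation on jets. -/

namespace JetGraph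

/-! ### The radical of the jet ideal. -/

section Algebra

/-- If the low coefficients of a product of two polynomials lie in a prime ideal, so do the
corresponding products of coefficients. -/
theorem coeff_mul_coeff_mem_of_isPrime {R : Type*} [CommRing R] {P : Ideal R} (hP : P.IsPrime)
    {p q : Polynomial R} {s : ℕ} (h : ∀ n ≤ s, (p * q).coeff n ∈ P) {i j : ℕ} (hij : i + j ≤ s) :
    p.coeff i * q.coeff j ∈ P := by
  classical
  by_contra hmem
  have hp : ∃ n, p.coeff n ∉ P := ⟨i, fun hi => hmem (P.mul_mem_right _ hi)⟩
  have hq : ∃ n, q.coeff n ∉ P := ⟨j, fun hj => hmem (P.mul_mem_left _ hj)⟩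
  have hi : Nat.find hp ≤ i := Nat.find_min' hp fun hi => hmem (P.mul_mem_right _ hi)
  have hj : Nat.find hq ≤ j := Nat.find_min' hq fun hj => hmem (P.mul_mem_left _ hj)
  -- In this coefficient, every term except the product of the two first coefficients outside `P`
  -- has a factor of smaller index, hence in `P`.
  have hsum := h (Nat.find hp + Nat.find hq) (by omega)
  rw [Polynomial.coeff_mul, ← Finset.add_sum_erase _ _
    (Finset.HasAntidiagonal.mem_antidiagonal.2 (rfl : (Nat.find hp, Nat.find hq).1 + _ = _))] at hsum
  refine (hP.mem_or_mem ((P.add_mem_iff_left (Ideal.sum_mem _ ?_)).1 hsum)).elim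
    (Nat.find_spec hp) (Nat.find_spec hq)
  rintro ⟨a, b⟩ hab
  simp only [Finset.mem_erase, Finset.HasAntidiagonal.mem_antidiagonal, ne_eq, Prod.mk.injEq] at hab
  rcases lt_or_ge a (Nat.find hp) with ha | ha
  · exact P.mul_mem_right _ (not_not.1 (Nat.find_min hp ha))
  · have hb : b < Nat.find hq := by omega
    exact P.mul_mem_left _ (not_not.1 (Nat.find_min hq hb))

variable (k : Type*) [Field k] {V : Type*}

/-- Setting variables outside the support of `m` to zero does not change the coefficient of `m`. -/
theorem coeff_aeval_indicator [DecidableEq V] (m : V →₀ ℕ) (f : MvPolynomial V k) :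
    (MvPolynomial.aeval (fun v => if v ∈ m.support then MvPolynomial.X v else 0) f :
      MvPolynomial V k).coeff m = f.coeff m := by
  induction f using MvPolynomial.induction_on' with
  | add p q hp hq => rw [map_add, MvPolynomial.coeff_add, MvPolynomial.coeff_add, hp, hq]
  | monomial u a =>
    by_cases hu : u.support ⊆ m.support
    · have : (MvPolynomial.aeval (fun v => if v ∈ m.support then MvPolynomial.X v else 0)
          (MvPolynomial.monomial u a) : MvPolynomial V k) = MvPolynomial.monomial u a := by
        rw [MvPolynomial.aeval_monomial, MvPolynomial.monomial_eq]
        refine congrArg _ (Finsupp.prod_congr fun v hv => ?_)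
        rw [if_pos (hu hv)]
      rw [this]
    · obtain ⟨v, hv, hvm⟩ := Finset.not_subset.1 hu
      have hz : (MvPolynomial.aeval (fun v => if v ∈ m.support then MvPolynomial.X v else 0)
          (MvPolynomial.monomial u a) : MvPolynomial V k) = 0 := by
        rw [MvPolynomial.aeval_monomial, Finsupp.prod, Finset.prod_eq_zero hv, mul_zero]
        rw [if_neg hvm, zero_pow (Finsupp.mem_support_iff.1 hv)]
      rw [hz, MvPolynomial.coeff_zero, MvPolynomial.coeff_monomial, if_neg]
      rintro rfl
      exact hvm hv

theorem monomial_mem_edgeIdeal {G : SimpleGraph V} {m : V →₀ ℕ} {x y : V} (hxy : G.Adj x y)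
    (hx : x ∈ m.support) (hy : y ∈ m.support) (a : k) :
    MvPolynomial.monomial m a ∈ edgeIdeal k G := by
  classical
  have hle : Finsupp.single x 1 + Finsupp.single y 1 ≤ m := by
    intro v
    have hx' := Nat.pos_of_ne_zero (Finsupp.mem_support_iff.1 hx)
    have hy' := Nat.pos_of_ne_zero (Finsupp.mem_support_iff.1 hy)
    have hne := hxy.ne
    simp only [Finsupp.add_apply, Finsupp.single_apply]
    split_ifs <;> simp_all <;> omega
  have hX : (MvPolynomial.X x * MvPolynomial.X y : MvPolynomial V k) ∈ edgeIdeal k G :=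
    Ideal.subset_span ⟨x, y, hxy, rfl⟩
  have := Ideal.mul_mem_left _
    (MvPolynomial.monomial (m - (Finsupp.single x 1 + Finsupp.single y 1)) a) hX
  rwa [MvPolynomial.X, MvPolynomial.X, MvPolynomial.monomial_mul, MvPolynomial.monomial_mul,
    tsub_add_cancel_of_le hle, mul_one, mul_one] at this

/-- If the support of a monomial `m` of `f` contains no edge, killing the variables outside that
support annihilates the edge ideal, hence `f ^ n` and so `f`; yet it preserves the coefficient of
`m`. -/
theorem edgeIdeal_isRadical (G : SimpleGraph V) : (edgeIdeal k G).IsRadical := by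
  classical
  rintro f ⟨n, hn⟩
  rw [f.as_sum]
  refine Ideal.sum_mem _ fun m hm => ?_
  by_cases hedge : ∃ x y, G.Adj x y ∧ x ∈ m.support ∧ y ∈ m.support
  · obtain ⟨x, y, hxy, hx, hy⟩ := hedge
    exact monomial_mem_edgeIdeal k hxy hx hy _
  exfalso
  let φ : MvPolynomial V k →ₐ[k] MvPolynomial V k :=
    MvPolynomial.aeval (fun v => if v ∈ m.support then MvPolynomial.X v else 0)
  have hle : edgeIdeal k G ≤ RingHom.ker φ := by
    refine Ideal.span_le.2 ?_
    rintro _ ⟨x, y, hxy, rfl⟩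
    by_cases hx : x ∈ m.support
    · have hy : y ∉ m.support := fun hy => hedge ⟨x, y, hxy, hx, hy⟩
      simp only [SetLike.mem_coe, RingHom.mem_ker, map_mul, φ, MvPolynomial.aeval_X, if_neg hy,
        mul_zero]
    · simp only [SetLike.mem_coe, RingHom.mem_ker, map_mul, φ, MvPolynomial.aeval_X, if_neg hx,
        zero_mul]
  have h0 : φ (f ^ n) = 0 := hle hn
  rw [map_pow] at h0
  have h1 := coeff_aeval_indicator k m f
  rw [show MvPolynomial.aeval _ f = (0 : MvPolynomial V k) from eq_zero_of_pow_eq_zero h0,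
    MvPolynomial.coeff_zero] at h1
  exact MvPolynomial.mem_support_iff.1 hm h1.symm

theorem coeff_jetHom_X (s : ℕ) (x : V) (i : Fin (s + 1)) :
    (jetHom k V s (MvPolynomial.X x)).coeff i = MvPolynomial.X (x, i) := by
  classical
  simp [jetHom, Polynomial.finsetSum_coeff, Polynomial.coeff_X_pow, Fin.val_inj]

/-- The graph on the jet variables in which `x_i` and `y_j` are adjacent when `x` and `y` are and
`i + j ≤ s`. -/
def truncatedProduct (G : SimpleGraph V) (s : ℕ) : SimpleGraph (JetVertex V s) where
  Adj a b := G.Adj a.1 b.1 ∧ (a.2 : ℕ) + b.2 ≤ s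
  symm := ⟨fun _ _ h => ⟨h.1.symm, by rw [add_comm]; exact h.2⟩⟩
  loopless := ⟨fun _ h => h.1.ne rfl⟩

theorem edgeIdeal_truncatedProduct (G : SimpleGraph V) (s : ℕ) :
    edgeIdeal k (truncatedProduct G s) = (jetIdeal s (edgeIdeal k G)).radical := by
  apply le_antisymm
  · refine Ideal.span_le.2 ?_
    rintro _ ⟨⟨x, i⟩, ⟨y, j⟩, ⟨hxy, hij⟩, rfl⟩
    rw [SetLike.mem_coe, Ideal.radical_eq_sInf, Submodule.mem_sInf]
    rintro P ⟨hle, hP⟩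
    rw [← coeff_jetHom_X k s x i, ← coeff_jetHom_X k s y j]
    refine coeff_mul_coeff_mem_of_isPrime hP (s := s) (fun n hn => ?_) hij
    rw [← map_mul]
    exact hle (Ideal.subset_span
      ⟨_, Ideal.subset_span ⟨x, y, hxy, rfl⟩, ⟨n, Nat.lt_succ_of_le hn⟩, rfl⟩)
  · rw [(edgeIdeal_isRadical k _).radical_le_iff, edgeIdeal, jetIdeal_span]
    refine Ideal.span_le.2 ?_
    rintro _ ⟨_, ⟨x, y, hxy, rfl⟩, n, rfl⟩
    rw [SetLike.mem_coe, map_mul, Polynomial.coeff_mul]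
    refine Ideal.sum_mem _ ?_
    rintro ⟨i, j⟩ hij
    have hij := Finset.HasAntidiagonal.mem_antidiagonal.1 hij
    have hn := n.2
    have hi := coeff_jetHom_X k s x ⟨i, by omega⟩
    have hj := coeff_jetHom_X k s y ⟨j, by omega⟩
    simp only at hi hj hij
    rw [hi, hj]
    refine Ideal.subset_span ⟨_, _, ⟨hxy, ?_⟩, rfl⟩
    simp only
    omega

end Algebra

/-! ### Very well-covered graphs and exchange permutations. -/

section Combinatorics

variable {V : Type*} {G : SimpleGraph V}

/-- In a very well-covered graph every vertex cover contains at least half of the vertices. -/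
theorem IsVeryWellCovered.card_le_two_mul_ncard [Finite V] (hG : IsVeryWellCovered G) {W : Set V}
    (hW : G.IsVertexCover W) : Nat.card V ≤ 2 * W.ncard := by
  obtain ⟨U, hUW, hU⟩ := exists_minimal_le_of_wellFoundedLT G.IsVertexCover W hW
  rw [← hG.2 U hU]
  exact Nat.mul_le_mul_left 2 (Set.ncard_le_ncard hUW)

/-- Hall's condition in a very well-covered graph. -/
theorem IsVeryWellCovered.card_le_card_biUnion_neighborFinset [Fintype V] [DecidableEq V]
    [DecidableRel G.Adj] (hG : IsVeryWellCovered G) (A : Finset V) :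
    A.card ≤ (A.biUnion (G.neighborFinset ·)).card := by
  induction A using Finset.strongInduction with
  | H A ih =>
    by_cases hind : ∃ u ∈ A, ∃ v ∈ A, G.Adj u v
    · obtain ⟨u, hu, v, hv, huv⟩ := hind
      -- `A \ I` lies in the neighbourhood of `A` and misses that of `I`, so Hall's condition for
      -- `I` gives it for `A`.
      let I := A.filter fun a => ∀ b ∈ A, ¬ G.Adj a b
      have hI : I ⊂ A := (Finset.filter_ssubset).2 ⟨u, hu, fun h => h v hv huv⟩
      have hdisj : Disjoint (A \ I) (I.biUnion (G.neighborFinset ·)) := by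
        rw [Finset.disjoint_left]
        intro b hb hbI
        obtain ⟨a, ha, hab⟩ := Finset.mem_biUnion.1 hbI
        exact (Finset.mem_filter.1 ha).2 b (Finset.mem_sdiff.1 hb).1
          ((G.mem_neighborFinset _ _).1 hab)
      have hsub : (A \ I) ∪ I.biUnion (G.neighborFinset ·) ⊆ A.biUnion (G.neighborFinset ·) := by
        refine Finset.union_subset (fun a ha => ?_)
          (Finset.biUnion_subset_biUnion_of_subset_left _ hI.1)
        simp only [I, Finset.mem_sdiff, Finset.mem_filter, not_and, not_forall, not_not] at ha
        obtain ⟨b, hb, hab⟩ := ha.2 ha.1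
        exact Finset.mem_biUnion.2 ⟨b, hb, (G.mem_neighborFinset _ _).2 hab.symm⟩
      have h1 := Finset.card_le_card hsub
      rw [Finset.card_union_of_disjoint hdisj] at h1
      have h2 := Finset.card_sdiff_add_card_eq_card hI.1
      have h3 := ih I hI
      omega
    -- For `A` independent, exchanging `A \ A'` for `B` in the minimal cover `C` leaves a cover.
    -- Induction on `A'` gives `|A'| ≤ |N| - |B| < |A| - |B|`, so the new cover is smaller than `C`,
    -- that is, below half the vertices.
    · by_contra! hlt
      have hnadj : ∀ u ∈ A, ∀ v ∈ A, ¬ G.Adj u v := by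
        simpa using hind
      set N := A.biUnion (G.neighborFinset ·) with hN
      have memN : ∀ {v}, v ∈ N ↔ ∃ a ∈ A, G.Adj a v := by simp [hN]
      obtain ⟨a, ha⟩ : A.Nonempty := Finset.card_pos.1 (by omega)
      obtain ⟨y, hay⟩ : ∃ y, G.Adj a y := by simpa [SimpleGraph.IsIsolated] using hG.1 a
      -- Avoiding `y` makes `B` contain a neighbour of `a`, so `A'` is a proper subset of `A`.
      obtain ⟨W, hWy, hW⟩ := exists_minimal_le_of_wellFoundedLT G.IsVertexCover {y}ᶜ
        (fun u v huv => by
          by_contra! h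
          simp only [Set.mem_compl_iff, Set.mem_singleton_iff, not_not] at h
          exact huv.ne (h.1.trans h.2.symm))
      have hyW : y ∉ W := fun h => hWy h rfl
      let C := W.toFinite.toFinset
      have memC : ∀ {v}, v ∈ C ↔ v ∈ W := by simp [C]
      let B := N \ C
      have hyB : y ∈ B := Finset.mem_sdiff.2 ⟨memN.2 ⟨a, ha, hay⟩, fun h => hyW (memC.1 h)⟩
      let A' := A.filter fun u => ∀ b ∈ B, ¬ G.Adj u b
      have hA' : A' ⊂ A := Finset.filter_ssubset.2 ⟨a, ha, fun h => h y hyB hay⟩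
      have hBA : A'.biUnion (G.neighborFinset ·) ⊆ N \ B := by
        intro v hv
        obtain ⟨u, hu, huv⟩ := Finset.mem_biUnion.1 hv
        rw [SimpleGraph.mem_neighborFinset] at huv
        rw [Finset.mem_filter] at hu
        exact Finset.mem_sdiff.2 ⟨memN.2 ⟨u, hu.1, huv⟩, fun hb => hu.2 v hb huv⟩
      have hAC : A \ A' ⊆ C := by
        intro u hu
        simp only [A', Finset.mem_sdiff, Finset.mem_filter, not_and, not_forall, not_not] at hu
        obtain ⟨b, hb, hub⟩ := hu.2 hu.1
        exact memC.2 ((hW.1 hub).resolve_right fun h => (Finset.mem_sdiff.1 hb).2 (memC.2 h))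
      have hcover : G.IsVertexCover (((C ∪ B) \ (A \ A') : Finset V) : Set V) := by
        have key : ∀ u v, G.Adj u v → u ∈ A → v ∈ (C ∪ B) \ (A \ A') := by
          intro u v huv hu
          have hv : v ∉ A := fun hv => hnadj u hu v hv huv
          have hvN : v ∈ N := memN.2 ⟨u, hu, huv⟩
          by_cases hvC : v ∈ C <;> simp [hv, hvC, B, hvN]
        intro u v huv
        simp only [Finset.mem_coe]
        by_cases hu : u ∈ A
        · exact Or.inr (key u v huv hu)
        by_cases hv : v ∈ A
        · exact Or.inl (key v u huv.symm hv)
        rcases hW.1 huv with h | h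
        · exact Or.inl (by simp [memC.2 h, hu])
        · exact Or.inr (by simp [memC.2 h, hv])
      have h1 := hG.card_le_two_mul_ncard hcover
      rw [Set.ncard_coe_finset, ← hG.2 W hW, Set.ncard_eq_toFinset_card W W.toFinite] at h1
      have h2 := Finset.card_sdiff_add_card_eq_card
        (hAC.trans (Finset.subset_union_left (s₂ := B)))
      have h3 := Finset.card_union_le C B
      have h4 := Finset.card_sdiff_add_card_eq_card hA'.1
      have h5 := ih A' hA'
      have h6 := Finset.card_le_card hBA
      have h7 : (N \ B).card + B.card = N.card :=
        Finset.card_sdiff_add_card_eq_card Finset.sdiff_subset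
      change 2 * C.card ≤ _ at h1
      omega

/-- A permutation moving each vertex `v` to a neighbour, such that every neighbour of `v` is
adjacent to every neighbour of the image of `v`. -/
structure IsExchangePerm (G : SimpleGraph V) (σ : Equiv.Perm V) : Prop where
  adj_apply (v : V) : G.Adj v (σ v)
  adj_of_adj {v a b : V} (ha : G.Adj v a) (hb : G.Adj (σ v) b) : G.Adj a b

theorem IsVeryWellCovered.exists_isExchangePerm [Finite V] (hG : IsVeryWellCovered G) :
    ∃ σ, IsExchangePerm G σ := by
  classical
  have := Fintype.ofFinite V
  obtain ⟨f, hf, hadj⟩ := (Finset.all_card_le_biUnion_card_iff_exists_injective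
    fun v => G.neighborFinset v).1 hG.card_le_card_biUnion_neighborFinset
  let σ := Equiv.ofBijective f (Finite.injective_iff_bijective.1 hf)
  have hσ : ∀ v, G.Adj v (σ v) := fun v => (G.mem_neighborFinset _ _).1 (hadj v)
  refine ⟨σ, hσ, fun {v a b} ha hb => ?_⟩
  by_contra hab
  -- A minimal cover avoiding `a` and `b` contains both `v` and `σ v`, making the inclusion of `Wᶜ`
  -- in `σ ⁻¹' W` strict, although both have half the vertices.
  obtain ⟨W, hWab, hW⟩ := exists_minimal_le_of_wellFoundedLT G.IsVertexCover {a, b}ᶜ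
    (fun u w huw => by
      by_contra! h
      simp only [Set.mem_compl_iff, Set.mem_insert_iff, Set.mem_singleton_iff, not_not] at h
      obtain ⟨rfl | rfl, rfl | rfl⟩ := h
      exacts [huw.ne rfl, hab huw, hab huw.symm, huw.ne rfl])
  have hv : v ∈ W := (hW.1 ha).resolve_right fun h => hWab h (by simp)
  have hσv : σ v ∈ W := (hW.1 hb).resolve_right fun h => hWab h (by simp)
  have hsub : Wᶜ ⊆ σ ⁻¹' W := fun u hu => (hW.1 (hσ u)).resolve_left hu
  have hssub : Wᶜ ⊂ σ ⁻¹' W := (Set.ssubset_iff_of_subset hsub).2 ⟨v, hσv, fun h => h hv⟩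
  have h1 := Set.ncard_lt_ncard hssub
  rw [Set.ncard_preimage_of_injective_subset_range σ.injective (by simp)] at h1
  have h2 := Set.ncard_add_ncard_compl W
  have h3 := hG.2 W hW
  omega

theorem IsMinimalVertexCover.exists_adj_notMem {W : Set V} (hW : IsMinimalVertexCover G W) {v : V}
    (hv : v ∈ W) : ∃ a, G.Adj v a ∧ a ∉ W := by
  by_contra! h
  refine (hW.2 (y := W \ {v}) (fun u w huw => ?_) Set.sdiff_subset hv).2 rfl
  by_cases hu : u = v
  · subst hu
    exact Or.inr ⟨h w huw, huw.ne'⟩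
  by_cases hw : w = v
  · subst hw
    exact Or.inl ⟨h u huw.symm, hu⟩
  exact (hW.1 huw).imp (fun h => ⟨h, hu⟩) (fun h => ⟨h, hw⟩)

theorem IsExchangePerm.isVeryWellCovered [Finite V] {σ : Equiv.Perm V} (hσ : IsExchangePerm G σ) :
    IsVeryWellCovered G := by
  refine ⟨fun v hv => hv _ (hσ.adj_apply v), fun W hW => ?_⟩
  -- If `v` and `σ v` were both in `W`, minimality would give each a neighbour outside `W`, and the
  -- exchange property would join these by an uncovered edge.
  have hcompl : Wᶜ = σ ⁻¹' W := by
    refine Set.Subset.antisymm (fun v hv => (hW.1 (hσ.adj_apply v)).resolve_left hv)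
      fun v hσv hv => ?_
    obtain ⟨a, ha, haW⟩ := hW.exists_adj_notMem hv
    obtain ⟨b, hb, hbW⟩ := hW.exists_adj_notMem hσv
    exact (hW.1 (hσ.adj_of_adj ha hb)).elim haW hbW
  have h := Set.ncard_add_ncard_compl W
  rw [hcompl, Set.ncard_preimage_of_injective_subset_range σ.injective (by simp)] at h
  omega

theorem IsExchangePerm.truncatedProduct {σ : Equiv.Perm V} (hσ : IsExchangePerm G σ) (s : ℕ) :
    IsExchangePerm (truncatedProduct G s) (Equiv.prodCongr σ Fin.revPerm) where
  adj_apply := by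
    rintro ⟨x, i⟩
    refine ⟨hσ.adj_apply x, ?_⟩
    simp only [Equiv.prodCongr_apply, Prod.map_apply, Fin.revPerm_apply, Fin.val_rev]
    omega
  adj_of_adj := by
    rintro ⟨x, i⟩ ⟨y, p⟩ ⟨z, q⟩ ⟨hy, hp⟩ ⟨hz, hq⟩
    refine ⟨hσ.adj_of_adj hy hz, ?_⟩
    simp only [Equiv.prodCongr_apply, Prod.map_apply, Fin.revPerm_apply, Fin.val_rev] at hp hq ⊢
    -- `p ≤ s - i` and `q ≤ i` add up to `p + q ≤ s`.
    omega

end Combinatorics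

end JetGraph

theorem mainTheorem2 (k : Type*) [Field k] {V : Type*} [Finite V] (G : SimpleGraph V)
    (hG : JetGraph.IsVeryWellCovered G) (s : ℕ) :
    JetGraph.edgeIdeal k (JetGraph.jetGraph k s G) =
        (JetGraph.jetIdeal s (JetGraph.edgeIdeal k G)).radical ∧
      JetGraph.IsVeryWellCovered (JetGraph.jetGraph k s G) := by
  have h := JetGraph.edgeIdeal_truncatedProduct k G s
  obtain ⟨σ, hσ⟩ := hG.exists_isExchangePerm
  rw [← JetGraph.eq_jetGraph_of_edgeIdeal_eq k s G _ h]
  exact ⟨h, (hσ.truncatedProduct s).isVeryWellCovered⟩
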